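/- Let $\ell\colon(0,\infty)\to\mathbb R$ be the $C^2$ solution of \[ \ell''(r)+\tfrac1r\,\ell'(r)=8\,r\,\sinh(2\ell(r)),\qquad r>0, \] with $\ell(r)\sim-\tfrac12\log r$ as $r\to0^+$ and $\ell(r)=O(e^{-cr})$ as $r\to\infty$ for some $c>0$. With $z=x+iy$ and $r=|z|$ on $\mathbb R^2=\mathbb C$ (Euclidean metric), let \[ A=\Big(\tfrac18+\tfrac r4\,\ell'(r)\Big)\begin{pmatrix}1&0\\0&-1\end{pmatrix}\Big(\frac{dz}{z}-\frac{d\bar z}{\bar z}\Big),\qquad \Phi=\begin{pmatrix}0&r^{1/2}e^{\ell(r)}\\ r^{-1/2}e^{-\ell(r)}z&0\end{pmatrix}dz \] be the fiducial solution $(A_1^{\mathrm{fid}},\Phi_1^{\mathrm{fid}})$ of the self-duality equations. Let $i\,\mathfrak{su}(2)$ be the space of trace-free Hermitian $2\times2$ matrices, with inner product $\langle a,b\rangle=\operatorname{Re}\operatorname{tr}(ab^*)$. For $\gamma\colon\mathbb R^2\to i\,\mathfrak{su}(2)$ put $d_A\gamma=d\gamma+[A,\gamma]$, $\Delta_A=d_A^*d_A$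 and \[ M_\Phi\gamma=[\Phi^*\wedge[\Phi,\gamma]]-[\Phi\wedge[\Phi^*,\gamma]]. \] Let $0<\alpha<1$ and let $\gamma\in C^{1,\alpha}_{\mathrm{loc}}(\mathbb R^2,i\,\mathfrak{su}(2))$ be bounded and a weak solution on $\mathbb R^2$ of \[ \Delta_A\gamma-i\ast M_\Phi\gamma=0, \] that is, \[ \int_{\mathbb R^2}\big(\langle d_A\gamma,d_A\eta\rangle+\langle -i\ast M_\Phi\gamma,\eta\rangle\big)\,dx\,dy=0\qquad\text{for all }\eta\in C_c^\infty(\mathbb R^2,i\,\mathfrak{su}(2)). \] Then $\gamma\equiv0$. -/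

import Mathlib

open scoped ContDiff Topology NNReal

noncomputable section

namespace Fiducial

/-- Complex `2 × 2` matrices. Regularity, derivatives and boundedness of matrix-valued functions
are understood entry by entry below (the space is finite-dimensional). -/
abbrev Mat : Type := Matrix (Fin 2) (Fin 2) ℂ

/-- The space `i 𝔰𝔲(2)` of trace-free Hermitian matrices, that is, of all
`!![u, v; conj v, -u]` with `u` real and `v` complex. -/
def isu2 : Set Mat := {m | m.IsHermitian ∧ m.trace = 0}

/-- The real inner product `Re tr (a bᴴ)` on matrices. -/
def inn (a b : Mat) : ℝ := (a * b.conjTranspose).trace.re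

/-- A matrix-valued `1`-form on the plane `ℂ = ℝ²`: `α z w` is the value at the point `z` on the
tangent vector `w` (real linear in `w` for all the forms below). -/
abbrev OneForm : Type := ℂ → ℂ → Mat

/-- A matrix-valued `2`-form on the plane. -/
abbrev TwoForm : Type := ℂ → ℂ → ℂ → Mat

/-- The adjoint `Φ*` of a `1`-form with respect to the standard Hermitian metric
(`(φ dz)* = φᴴ dz̄`). -/
def OneForm.adj (Φ : OneForm) : OneForm := fun z w => (Φ z w).conjTranspose

/-- The `1`-form `[Φ, γ]`, for a `1`-form `Φ` and a `0`-form `γ`. -/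
def OneForm.bracket (Φ : OneForm) (γ : ℂ → Mat) : OneForm := fun z w => ⁅Φ z w, γ z⁆

/-- The `2`-form `[α ∧ β] = α ∧ β + β ∧ α`, for `1`-forms `α` and `β`. -/
def OneForm.wedge (α β : OneForm) : TwoForm :=
  fun z w₁ w₂ => ⁅α z w₁, β z w₂⁆ - ⁅α z w₂, β z w₁⁆

/-- The Hodge star of a `2`-form for the Euclidean metric `dx² + dy²`: `∗(f dx ∧ dy) = f`. -/
def TwoForm.star (σ : TwoForm) : ℂ → Mat := fun z => σ z 1 Complex.I

/-- `M_Φ γ = [Φ* ∧ [Φ, γ]] - [Φ ∧ [Φ*, γ]]`. -/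
def higgsM (Φ : OneForm) (γ : ℂ → Mat) : TwoForm := fun z w₁ w₂ =>
  Φ.adj.wedge (Φ.bracket γ) z w₁ w₂ - Φ.wedge (Φ.adj.bracket γ) z w₁ w₂

/-- The zeroth order operator `γ ↦ -i ∗ M_Φ γ`. -/
def higgsPotential (Φ : OneForm) (γ : ℂ → Mat) : ℂ → Mat :=
  fun z => (-Complex.I) • TwoForm.star (higgsM Φ γ) z

/-- The exterior derivative `dγ` of a matrix-valued function, as a `1`-form. -/
def matDeriv (γ : ℂ → Mat) : OneForm :=
  fun z w => Matrix.of fun i j => fderiv ℝ (fun x => γ x i j) z w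

/-- The covariant derivative `d_A γ = dγ + [A, γ]`, as a `1`-form. -/
def covDeriv (A : OneForm) (γ : ℂ → Mat) : OneForm :=
  fun z w => matDeriv γ z w + ⁅A z w, γ z⁆

/-- The pointwise inner product of two `1`-forms, for the Euclidean metric on the plane. -/
def OneForm.inn (α β : OneForm) : ℂ → ℝ := fun z =>
  Fiducial.inn (α z 1) (β z 1) + Fiducial.inn (α z Complex.I) (β z Complex.I)

/-- `γ` is a weak solution on the plane of `Δ_A γ - i ∗ M_Φ γ = 0`, where
`Δ_A = d_A^* d_A`, tested against smooth compactly supported sections of `i 𝔰𝔲(2)`. -/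
def IsWeakSolution (A Φ : OneForm) (γ : ℂ → Mat) : Prop :=
  ∀ η : ℂ → Mat, (∀ i j, ContDiff ℝ ∞ (fun z => η z i j)) → HasCompactSupport η →
    (∀ z, η z ∈ isu2) →
    ∫ z : ℂ, ((covDeriv A γ).inn (covDeriv A η) z + inn (higgsPotential Φ γ z) (η z)) = 0

/-- The class `C^{1,α}_loc` on the plane. -/
def IsC1HolderLoc (α : ℝ≥0) (γ : ℂ → Mat) : Prop :=
  ∀ i j, ContDiff ℝ 1 (fun z => γ z i j) ∧ ∀ K : Set ℂ, IsCompact K →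
    ∃ C : ℝ≥0, HolderOnWith C α (fderiv ℝ (fun z => γ z i j)) K

/-- The matrix-valued function `γ` is bounded on the plane. -/
def IsBdd (γ : ℂ → Mat) : Prop := ∃ C : ℝ, ∀ z i j, ‖γ z i j‖ ≤ C

/-- `ℓ` is the profile function `ℓ_t` of the fiducial solution: the solution on `(0, ∞)` of
`ℓ'' + ℓ'/r = 8 t² r sinh (2 ℓ)` with `ℓ ∼ -(1/2) log r` as `r → 0` that decays exponentially
as `r → ∞`. -/
structure IsFiducialProfile (t : ℝ) (ℓ : ℝ → ℝ) : Prop where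
  contDiffOn : ContDiffOn ℝ 2 ℓ (Set.Ioi 0)
  ode : ∀ r : ℝ, 0 < r →
    deriv (deriv ℓ) r + 1 / r * deriv ℓ r = 8 * t ^ 2 * r * Real.sinh (2 * ℓ r)
  asymp_zero : Asymptotics.IsEquivalent (𝓝[>] 0) ℓ (fun r => -(1 / 2) * Real.log r)
  decay : ∃ c : ℝ, 0 < c ∧ Asymptotics.IsBigO Filter.atTop ℓ (fun r => Real.exp (-c * r))

/-- The connection form
`A = (1/8 + (r/4) ℓ'(r)) diag(1, -1) (dz/z - dz̄/z̄)` with profile `ℓ`, where `r = |z|`. -/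
def fidA (ℓ : ℝ → ℝ) : OneForm := fun z w =>
  (((1 / 8 + ‖z‖ / 4 * deriv ℓ ‖z‖ : ℝ) : ℂ) *
    (w / z - starRingEnd ℂ w / starRingEnd ℂ z)) • !![1, 0; 0, -1]

/-- The Higgs field `Φ = !![0, r^{1/2} e^ℓ; r^{-1/2} e^{-ℓ} z, 0] dz` with profile `ℓ`,
where `r = |z|`. -/
def fidPhi (ℓ : ℝ → ℝ) : OneForm := fun z w =>
  w • !![0, ((‖z‖ ^ (1 / 2 : ℝ) * Real.exp (ℓ ‖z‖) : ℝ) : ℂ);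
    ((‖z‖ ^ (-(1 / 2) : ℝ) * Real.exp (-ℓ ‖z‖) : ℝ) : ℂ) * z, 0]

end Fiducial

end

/-!
Test the equation with `ψ γ`, for a smooth compactly supported `ψ`. This gives
`∫ (ψ e + ∑_w ∂_w ψ ⟨d_A γ(w), γ⟩) = 0` with the energy density
`e = |d_A γ|² + ⟨-i ∗ M_Φ γ, γ⟩` (`IsWeakSolution.integral_energyDensity`), in other words
`½ Δ|γ|² = e` weakly. The zeroth order term equals `4 |[φ, γ]|² ≥ 0` (`inn_higgsPotential`), so
`|γ|²` is a bounded subharmonic function on the plane. Cutoffs on dyadic discs have bounded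
Dirichlet energy, and the Caccioppoli inequality then forces `e = 0`
(`ae_eq_zero_of_weak_divergence`). Hence `d_A γ = 0`, so that `|γ|` is constant because `A` is
metric (`fderiv_inn_self`), and `γ` commutes with `φ`. As `ℓ ∼ -½ log r` is positive near the
origin, the two off-diagonal entries of `φ` have different moduli there and only `0` commutes with
`φ` (`eq_zero_of_lie_fidPhi_eq_zero`). So `γ` vanishes at some point, and therefore everywhere.

The integrals in the weak formulation are meaningful because `A` and `Φ` are locally bounded also
at the origin. For `A` this requires `r ℓ' + ½ = O(r)`, which follows from the differential equation
(`isFiducialProfile_one_asymp`); the connection form is `O(1)` only because the term `1/8` cancels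
the limit of `(r/4) ℓ'`.
-/

namespace Fiducial

open Filter Set MeasureTheory
open scoped Convolution

/-! ### The profile near the origin -/

theorem isFiducialProfile_hasDerivAt {t : ℝ} {ℓ : ℝ → ℝ} (hℓ : IsFiducialProfile t ℓ) {r : ℝ}
    (hr : 0 < r) : HasDerivAt ℓ (deriv ℓ r) r :=
  ((hℓ.contDiffOn.differentiableOn (by norm_num)).differentiableAt
    (isOpen_Ioi.mem_nhds hr)).hasDerivAt

theorem isFiducialProfile_contDiffOn_deriv {t : ℝ} {ℓ : ℝ → ℝ} (hℓ : IsFiducialProfile t ℓ) :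
    ContDiffOn ℝ 1 (deriv ℓ) (Ioi 0) :=
  hℓ.contDiffOn.deriv_of_isOpen isOpen_Ioi (by norm_num)

theorem isFiducialProfile_hasDerivAt_mul_deriv {t : ℝ} {ℓ : ℝ → ℝ} (hℓ : IsFiducialProfile t ℓ)
    {r : ℝ} (hr : 0 < r) :
    HasDerivAt (fun s => s * deriv ℓ s) (8 * t ^ 2 * r ^ 2 * Real.sinh (2 * ℓ r)) r := by
  have h := ((isFiducialProfile_contDiffOn_deriv hℓ).differentiableOn
    (by norm_num)).differentiableAt (isOpen_Ioi.mem_nhds hr) |>.hasDerivAt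
  refine ((hasDerivAt_id r).mul h).congr_deriv ?_
  have := hℓ.ode r hr
  simp only [id]
  field_simp at this
  linarith

theorem isFiducialProfile_one_bounds {ℓ : ℝ → ℝ} (hℓ : IsFiducialProfile 1 ℓ) :
    ∃ δ : ℝ, 0 < δ ∧ δ ≤ 1 ∧ ∀ r ∈ Ioo 0 δ, 0 < ℓ r ∧ ℓ r ≤ -(3 / 4) * Real.log r := by
  have h := (hℓ.asymp_zero.def (by norm_num : (0 : ℝ) < 1 / 2))
  obtain ⟨δ, hδ, h⟩ := mem_nhdsGT_iff_exists_Ioo_subset.1 h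
  refine ⟨min δ 1, lt_min hδ one_pos, min_le_right _ _, fun r hr => ?_⟩
  have hr1 := h ⟨hr.1, hr.2.trans_le (min_le_left _ _)⟩
  have hlog := Real.log_neg hr.1 (hr.2.trans_le (min_le_right _ _))
  simp only [mem_ofPred_eq, Pi.sub_apply, Real.norm_eq_abs] at hr1
  rw [abs_of_pos (by linarith : 0 < -(1 / 2) * Real.log r), abs_le] at hr1
  constructor <;> linarith [hr1.1, hr1.2]

/-- The first order asymptotics of the profile at the origin. The equation reads
`(r ℓ')' = 8 r² sinh (2 ℓ)`, whose right-hand side is bounded near `0`; so `r ℓ'` is Lipschitz and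
has a limit `L`, and `ℓ = L log r + O(1)` forces `L = -1/2`. -/
theorem isFiducialProfile_one_asymp {ℓ : ℝ → ℝ} (hℓ : IsFiducialProfile 1 ℓ) :
    ∃ δ C : ℝ, 0 < δ ∧ ∀ r ∈ Ioo 0 δ, 0 < ℓ r ∧ |r * deriv ℓ r + 1 / 2| ≤ 8 * r ∧
      |ℓ r + 1 / 2 * Real.log r| ≤ C := by
  obtain ⟨δ, hδ, hδ1, hb⟩ := isFiducialProfile_one_bounds hℓ
  have hlip : LipschitzOnWith 8 (fun s => s * deriv ℓ s) (Ioo 0 δ) := by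
    refine (convex_Ioo 0 δ).lipschitzOnWith_of_nnnorm_hasDerivWithin_le
      (fun r hr => (isFiducialProfile_hasDerivAt_mul_deriv hℓ hr.1).hasDerivWithinAt)
      fun r hr => ?_
    obtain ⟨h0, h1⟩ := hb r hr
    have hlog : Real.log r ≤ 0 := Real.log_nonpos hr.1.le (hr.2.le.trans hδ1)
    have hs : 0 ≤ Real.sinh (2 * ℓ r) := Real.sinh_nonneg_iff.2 (by linarith)
    have hs' : Real.sinh (2 * ℓ r) ≤ Real.exp (2 * ℓ r) := by
      rw [Real.sinh_eq]
      linarith [Real.exp_pos (2 * ℓ r), Real.exp_pos (-(2 * ℓ r))]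
    have hr2 : r ^ 2 = Real.exp (2 * Real.log r) := by
      rw [mul_comm, Real.exp_mul, Real.exp_log hr.1]; norm_cast
    have : r ^ 2 * Real.sinh (2 * ℓ r) ≤ 1 := by
      calc r ^ 2 * Real.sinh (2 * ℓ r) ≤ Real.exp (2 * Real.log r) * Real.exp (2 * ℓ r) := by
            rw [hr2]; gcongr
        _ = Real.exp (2 * Real.log r + 2 * ℓ r) := (Real.exp_add _ _).symm
        _ ≤ 1 := Real.exp_le_one_iff.2 (by linarith)
    rw [← NNReal.coe_le_coe, coe_nnnorm, Real.norm_eq_abs, abs_of_nonneg (by positivity)]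
    push_cast
    linarith
  obtain ⟨g, hg, hfg⟩ := hlip.extend_real
  set L := g 0 with hL
  have hf : ∀ r ∈ Ioo 0 δ, |r * deriv ℓ r - L| ≤ 8 * r := by
    intro r hr
    have h1 := hg.dist_le_mul r 0
    rw [← hfg hr, Real.dist_eq, Real.dist_eq, sub_zero, abs_of_pos hr.1] at h1
    simpa using h1
  have hlip2 : LipschitzOnWith 8 (fun s => ℓ s - L * Real.log s) (Ioo 0 δ) := by
    refine (convex_Ioo 0 δ).lipschitzOnWith_of_nnnorm_hasDerivWithin_le
      (fun r hr => ((isFiducialProfile_hasDerivAt hℓ hr.1).sub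
        ((Real.hasDerivAt_log hr.1.ne').const_mul L)).hasDerivWithinAt)
      fun r hr => ?_
    have hr0 := hr.1
    have : deriv ℓ r - L * r⁻¹ = (r * deriv ℓ r - L) / r := by field_simp
    rw [← NNReal.coe_le_coe, coe_nnnorm, Real.norm_eq_abs, this, abs_div, abs_of_pos hr.1,
      div_le_iff₀ hr.1]
    exact hf r hr
  have hbd : ∀ r ∈ Ioo 0 δ, |ℓ r - L * Real.log r| ≤
      |ℓ (δ / 2) - L * Real.log (δ / 2)| + 8 := by
    intro r hr
    have h1 := hlip2.dist_le_mul r hr (δ / 2) ⟨by linarith, by linarith⟩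
    rw [Real.dist_eq, Real.dist_eq] at h1
    have h2 : |r - δ / 2| ≤ 1 := abs_le.2 ⟨by linarith [hr.1], by linarith [hr.2]⟩
    have h3 := abs_sub_abs_le_abs_sub (ℓ r - L * Real.log r) (ℓ (δ / 2) - L * Real.log (δ / 2))
    push_cast at h1
    linarith
  have hev : ∀ᶠ r in 𝓝[>] (0 : ℝ), r ∈ Ioo 0 δ := Ioo_mem_nhdsGT hδ
  have hLeq : L = -(1 / 2) := by
    by_contra hne
    have hlog : Tendsto (fun r => ‖Real.log r‖) (𝓝[>] (0 : ℝ)) atTop :=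
      tendsto_abs_atBot_atTop.comp Real.tendsto_log_nhdsGT_zero
    have h1 : (fun r => ℓ r - L * Real.log r) =o[𝓝[>] 0] Real.log := by
      have hO : (fun r => ℓ r - L * Real.log r) =O[𝓝[>] 0] (fun _ => (1 : ℝ)) :=
        Asymptotics.IsBigO.of_bound _ (hev.mono fun r hr => by simpa using hbd r hr)
      exact hO.trans_isLittleO (Asymptotics.isLittleO_const_left.2 (Or.inr hlog))
    have h2 : (fun r => ℓ r - -(1 / 2) * Real.log r) =o[𝓝[>] 0] Real.log :=
      (Asymptotics.IsLittleO.of_const_mul_right hℓ.asymp_zero)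
    have h3 : (fun r => (L - -(1 / 2)) * Real.log r) =o[𝓝[>] 0] Real.log :=
      (h2.sub h1).congr_left fun r => by ring
    have h4 := (Asymptotics.isLittleO_const_mul_left_iff (sub_ne_zero.2 hne)).1 h3
    refine Asymptotics.isLittleO_irrefl' ?_ h4
    exact ((hlog.eventually_gt_atTop 0).mono fun r hr => hr.ne').frequently
  refine ⟨δ, |ℓ (δ / 2) - L * Real.log (δ / 2)| + 8, hδ, fun r hr => ⟨(hb r hr).1, ?_, ?_⟩⟩
  · have := hf r hr
    rwa [hLeq, sub_neg_eq_add] at this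
  · have := hbd r hr
    rw [hLeq] at this ⊢
    convert this using 2
    ring

/-! ### Locally bounded coefficients -/

/-- Measurable functions on the plane that are bounded on every disc. All coefficients of the
equation are of this kind, including the connection form and the Higgs field at the origin. -/
def LocBdd {E : Type*} [NormedAddCommGroup E] (f : ℂ → E) : Prop :=
  AEStronglyMeasurable f volume ∧ ∀ R : ℝ, ∃ C : ℝ, ∀ z, ‖z‖ ≤ R → ‖f z‖ ≤ C

namespace LocBdd

variable {E : Type*} [NormedAddCommGroup E]

theorem of_continuous {f : ℂ → E} (hf : Continuous f) : LocBdd f := by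
  refine ⟨hf.aestronglyMeasurable, fun R => ?_⟩
  obtain ⟨C, hC⟩ := (isCompact_closedBall (0 : ℂ) R).exists_bound_of_continuousOn hf.continuousOn
  exact ⟨C, fun z hz => hC z (by simpa using hz)⟩

theorem add {f g : ℂ → E} (hf : LocBdd f) (hg : LocBdd g) : LocBdd fun z => f z + g z := by
  refine ⟨hf.1.add hg.1, fun R => ?_⟩
  obtain ⟨C, hC⟩ := hf.2 R
  obtain ⟨C', hC'⟩ := hg.2 R
  exact ⟨C + C', fun z hz => norm_add_le_of_le (hC z hz) (hC' z hz)⟩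

theorem neg {f : ℂ → E} (hf : LocBdd f) : LocBdd fun z => -f z :=
  ⟨hf.1.neg, fun R => (hf.2 R).imp fun C hC z hz => by simpa using hC z hz⟩

theorem sub {f g : ℂ → E} (hf : LocBdd f) (hg : LocBdd g) : LocBdd fun z => f z - g z := by
  simpa only [sub_eq_add_neg] using hf.add hg.neg

theorem mul {𝕜 : Type*} [RCLike 𝕜] {f g : ℂ → 𝕜} (hf : LocBdd f) (hg : LocBdd g) :
    LocBdd fun z => f z * g z := by
  refine ⟨hf.1.mul hg.1, fun R => ?_⟩
  obtain ⟨C, hC⟩ := hf.2 R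
  obtain ⟨C', hC'⟩ := hg.2 R
  refine ⟨C * C', fun z hz => ?_⟩
  rw [norm_mul]
  exact mul_le_mul (hC z hz) (hC' z hz) (norm_nonneg _) ((norm_nonneg _).trans (hC z hz))

theorem star {f : ℂ → ℂ} (hf : LocBdd f) : LocBdd fun z => Star.star (f z) :=
  ⟨hf.1.star, fun R => (hf.2 R).imp fun C hC z hz => by simpa using hC z hz⟩

theorem re {f : ℂ → ℂ} (hf : LocBdd f) : LocBdd fun z => (f z).re :=
  ⟨hf.1.re, fun R => (hf.2 R).imp fun _ hC z hz =>
    (Complex.abs_re_le_norm _).trans (hC z hz)⟩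

/-- To be locally bounded it suffices to be continuous off the origin and bounded on punctured
discs. -/
theorem of_punctured {f : ℂ → E} (hf : ContinuousOn f {0}ᶜ)
    (hb : ∀ R : ℝ, ∃ C : ℝ, ∀ z, z ≠ 0 → ‖z‖ ≤ R → ‖f z‖ ≤ C) : LocBdd f := by
  refine ⟨?_, fun R => ?_⟩
  · have := hf.aestronglyMeasurable (μ := volume) (measurableSet_singleton (0 : ℂ)).compl
    have hae : ∀ᵐ z : ℂ, z ∈ ({0}ᶜ : Set ℂ) := compl_mem_ae_iff.2 (measure_singleton 0)
    rwa [Measure.restrict_eq_self_of_ae_mem hae] at this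
  · obtain ⟨C, hC⟩ := hb R
    refine ⟨max C ‖f 0‖, fun z hz => ?_⟩
    rcases eq_or_ne z 0 with rfl | h
    · exact le_max_right _ _
    · exact (hC z h hz).trans (le_max_left _ _)

theorem integrable_of_eq_zero {f : ℂ → E} (hf : LocBdd f) {R : ℝ}
    (hR : ∀ z, R < ‖z‖ → f z = 0) : Integrable f := by
  obtain ⟨C, hC⟩ := hf.2 R
  have h : IntegrableOn f (Metric.closedBall 0 R) :=
    Measure.integrableOn_of_bounded (measure_closedBall_lt_top).ne hf.1 (M := C)
      ((ae_restrict_mem measurableSet_closedBall).mono fun z hz => hC z (by simpa using hz))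
  refine (integrableOn_iff_integrable_of_support_subset fun z hz => ?_).1 h
  by_contra hn
  exact hz (hR z (by simpa using hn))

theorem integrableOn_ball {f : ℂ → E} (hf : LocBdd f) (R : ℝ) :
    IntegrableOn f (Metric.ball 0 R) := by
  obtain ⟨C, hC⟩ := hf.2 R
  refine Measure.integrableOn_of_bounded (measure_ball_lt_top).ne hf.1 (M := C)
      ((ae_restrict_mem measurableSet_ball).mono fun z hz => hC z ?_)
  exact (by simpa using hz : ‖z‖ < R).le

end LocBdd

/-- Entrywise local boundedness of a matrix-valued function. -/
def MatLocBdd (F : ℂ → Mat) : Prop := ∀ i j, LocBdd fun z => F z i j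

namespace MatLocBdd

theorem add {F G : ℂ → Mat} (hF : MatLocBdd F) (hG : MatLocBdd G) :
    MatLocBdd fun z => F z + G z := fun i j => (hF i j).add (hG i j)

theorem sub {F G : ℂ → Mat} (hF : MatLocBdd F) (hG : MatLocBdd G) :
    MatLocBdd fun z => F z - G z := fun i j => (hF i j).sub (hG i j)

theorem mul {F G : ℂ → Mat} (hF : MatLocBdd F) (hG : MatLocBdd G) :
    MatLocBdd fun z => F z * G z := fun i j => by
  simp only [Matrix.mul_apply, Fin.sum_univ_two]
  exact ((hF i 0).mul (hG 0 j)).add ((hF i 1).mul (hG 1 j))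

theorem lie {F G : ℂ → Mat} (hF : MatLocBdd F) (hG : MatLocBdd G) :
    MatLocBdd fun z => ⁅F z, G z⁆ := by
  simp only [Ring.lie_def]
  exact (hF.mul hG).sub (hG.mul hF)

theorem conjTranspose {F : ℂ → Mat} (hF : MatLocBdd F) :
    MatLocBdd fun z => (F z).conjTranspose := fun i j => (hF j i).star

theorem smul {f : ℂ → ℂ} {F : ℂ → Mat} (hf : LocBdd f) (hF : MatLocBdd F) :
    MatLocBdd fun z => f z • F z := fun i j => hf.mul (hF i j)

theorem const (m : Mat) : MatLocBdd fun _ => m := fun _ _ => .of_continuous continuous_const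

theorem inn {F G : ℂ → Mat} (hF : MatLocBdd F) (hG : MatLocBdd G) :
    LocBdd fun z => Fiducial.inn (F z) (G z) := by
  simp only [Fiducial.inn, Matrix.trace_fin_two]
  exact ((hF.mul hG.conjTranspose 0 0).add (hF.mul hG.conjTranspose 1 1)).re

theorem higgsPotential {Φ : OneForm} {γ : ℂ → Mat} (hΦ : ∀ w, MatLocBdd fun z => Φ z w)
    (hγ : MatLocBdd γ) : MatLocBdd (Fiducial.higgsPotential Φ γ) := by
  have hadj : ∀ w, MatLocBdd fun z => Φ.adj z w := fun w => (hΦ w).conjTranspose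
  have h1 : ∀ w, MatLocBdd fun z => Φ.bracket γ z w := fun w => (hΦ w).lie hγ
  have h2 : ∀ w, MatLocBdd fun z => Φ.adj.bracket γ z w := fun w => (hadj w).lie hγ
  exact smul (.of_continuous continuous_const)
    ((((hadj _).lie (h1 _)).sub ((hadj _).lie (h1 _))).sub
      (((hΦ _).lie (h2 _)).sub ((hΦ _).lie (h2 _))))

theorem covDeriv {A : OneForm} {γ : ℂ → Mat} (hA : ∀ w, MatLocBdd fun z => A z w)
    (hγ : ∀ i j, ContDiff ℝ 1 fun z => γ z i j) (w : ℂ) :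
    MatLocBdd fun z => Fiducial.covDeriv A γ z w :=
  add (fun i j => .of_continuous
      (((hγ i j).continuous_fderiv one_ne_zero).clm_apply continuous_const))
    ((hA w).lie fun i j => .of_continuous (hγ i j).continuous)

end MatLocBdd

/-! ### Local boundedness of the fiducial solution -/

/-- The bounds on the profile that make the connection form and the Higgs field bounded on
punctured discs. -/
theorem isFiducialProfile_one_bdd {ℓ : ℝ → ℝ} (hℓ : IsFiducialProfile 1 ℓ) (R : ℝ) :
    ∃ C : ℝ, ∀ r, 0 < r → r ≤ R → |1 / 8 + r / 4 * deriv ℓ r| ≤ C * r ∧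
      r ^ (1 / 2 : ℝ) * Real.exp (ℓ r) ≤ C ∧ r ^ (1 / 2 : ℝ) * Real.exp (-ℓ r) ≤ C := by
  obtain ⟨δ, K, hδ, h⟩ := isFiducialProfile_one_asymp hℓ
  have hsub : Icc (δ / 2) R ⊆ Ioi 0 := fun r hr => (half_pos hδ).trans_le hr.1
  have hc0 : ContinuousOn ℓ (Icc (δ / 2) R) := hℓ.contDiffOn.continuousOn.mono hsub
  have hc1 : ContinuousOn (deriv ℓ) (Icc (δ / 2) R) :=
    (isFiducialProfile_contDiffOn_deriv hℓ).continuousOn.mono hsub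
  have hne : ∀ r ∈ Icc (δ / 2) R, r ≠ 0 := fun r hr => (hsub hr).ne'
  have hrp : ContinuousOn (fun r : ℝ => r ^ (1 / 2 : ℝ)) (Icc (δ / 2) R) :=
    continuousOn_id.rpow_const fun r hr => Or.inl (hne r hr)
  obtain ⟨C1, hC1⟩ := isCompact_Icc.exists_bound_of_continuousOn
    (f := fun r => (1 / 8 + r / 4 * deriv ℓ r) / r) (by fun_prop (disch := assumption))
  obtain ⟨C2, hC2⟩ := isCompact_Icc.exists_bound_of_continuousOn (hrp.mul hc0.rexp)
  obtain ⟨C3, hC3⟩ := isCompact_Icc.exists_bound_of_continuousOn (hrp.mul hc0.neg.rexp)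
  refine ⟨max (max (max C1 C2) C3) (max 2 (Real.exp K)), fun r hr0 hrR => ?_⟩
  rcases lt_or_ge r δ with hr | hr
  · obtain ⟨-, h1, h2⟩ := h r ⟨hr0, hr⟩
    have hexp : r ^ (1 / 2 : ℝ) = Real.exp (1 / 2 * Real.log r) := by
      rw [Real.rpow_def_of_pos hr0, mul_comm]
    refine ⟨?_, le_max_of_le_right (le_max_of_le_right ?_),
      le_max_of_le_right (le_max_of_le_right ?_)⟩
    · calc |1 / 8 + r / 4 * deriv ℓ r| = |r * deriv ℓ r + 1 / 2| / 4 := by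
            rw [← abs_of_pos (by norm_num : (0 : ℝ) < 4), ← abs_div,
              abs_of_pos (by norm_num : (0 : ℝ) < 4)]
            congr 1; ring
        _ ≤ 2 * r := by linarith
        _ ≤ _ := by gcongr; exact le_max_of_le_right (le_max_left _ _)
    · rw [hexp, ← Real.exp_add]
      exact Real.exp_le_exp.2 (by linarith [(abs_le.1 h2).2])
    · rw [hexp, ← Real.exp_add]
      have h3 := (h r ⟨hr0, hr⟩).1
      exact Real.exp_le_exp.2 (by linarith [(abs_le.1 h2).2])
  · have hm : r ∈ Icc (δ / 2) R := ⟨by linarith, hrR⟩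
    refine ⟨?_, ((le_abs_self _).trans (hC2 r hm)).trans ?_,
      ((le_abs_self _).trans (hC3 r hm)).trans ?_⟩
    · have := hC1 r hm
      rw [Real.norm_eq_abs, abs_div, abs_of_pos hr0, div_le_iff₀ hr0] at this
      refine this.trans ?_
      gcongr
      simp
    · simp
    · simp

theorem matLocBdd_fidA {ℓ : ℝ → ℝ} (hℓ : IsFiducialProfile 1 ℓ) (w : ℂ) :
    MatLocBdd fun z => fidA ℓ z w := by
  refine MatLocBdd.smul (.of_punctured ?_ fun R => ?_) (.const _)
  · have hn : ∀ z ∈ ({0}ᶜ : Set ℂ), z ≠ 0 := fun z hz => hz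
    have hs : ∀ z ∈ ({0}ᶜ : Set ℂ), (starRingEnd ℂ) z ≠ 0 := fun z hz => by simpa using hz
    have hd : ContinuousOn (fun z : ℂ => deriv ℓ ‖z‖) {0}ᶜ :=
      (isFiducialProfile_contDiffOn_deriv hℓ).continuousOn.comp continuous_norm.continuousOn
        fun z hz => norm_pos_iff.2 hz
    have hc : ContinuousOn (fun z : ℂ => (starRingEnd ℂ) z) {0}ᶜ :=
      Complex.continuous_conj.continuousOn
    refine ContinuousOn.mul (Complex.continuous_ofReal.comp_continuousOn (by fun_prop)) ?_
    exact (continuousOn_const.div continuousOn_id hn).sub (continuousOn_const.div hc hs)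
  · obtain ⟨C, hC⟩ := isFiducialProfile_one_bdd hℓ R
    refine ⟨C * (2 * ‖w‖), fun z hz hzR => ?_⟩
    have hz0 := norm_pos_iff.2 hz
    have h1 := (hC _ hz0 hzR).1
    have h2 : ‖w / z - starRingEnd ℂ w / starRingEnd ℂ z‖ ≤ 2 * ‖w‖ / ‖z‖ := by
      refine (norm_sub_le _ _).trans (le_of_eq ?_)
      simp only [norm_div, RCLike.norm_conj]
      ring
    rw [norm_mul, Complex.norm_real, Real.norm_eq_abs]
    calc _ ≤ C * ‖z‖ * (2 * ‖w‖ / ‖z‖) :=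
          mul_le_mul h1 h2 (norm_nonneg _) ((abs_nonneg _).trans h1)
      _ = _ := by field_simp

theorem matLocBdd_fidPhi {ℓ : ℝ → ℝ} (hℓ : IsFiducialProfile 1 ℓ) (w : ℂ) :
    MatLocBdd fun z => fidPhi ℓ z w := by
  have hl : ContinuousOn (fun z : ℂ => ℓ ‖z‖) {0}ᶜ :=
    hℓ.contDiffOn.continuousOn.comp continuous_norm.continuousOn fun z hz => norm_pos_iff.2 hz
  have hr (s : ℝ) : ContinuousOn (fun z : ℂ => ‖z‖ ^ s) {0}ᶜ :=
    continuous_norm.continuousOn.rpow_const fun z hz => Or.inl (norm_ne_zero_iff.2 hz)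
  refine MatLocBdd.smul (.of_continuous continuous_const) ?_
  have hz : LocBdd fun _ : ℂ => (0 : ℂ) := .of_continuous continuous_const
  have h1 : LocBdd fun z : ℂ => ((‖z‖ ^ (1 / 2 : ℝ) * Real.exp (ℓ ‖z‖) : ℝ) : ℂ) := by
    refine .of_punctured (Complex.continuous_ofReal.comp_continuousOn ((hr _).mul hl.rexp))
      fun R => ?_
    obtain ⟨C, hC⟩ := isFiducialProfile_one_bdd hℓ R
    refine ⟨C, fun z hz hzR => ?_⟩
    rw [Complex.norm_real, Real.norm_eq_abs, abs_of_nonneg (by positivity)]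
    exact (hC _ (norm_pos_iff.2 hz) hzR).2.1
  have h2 : LocBdd fun z : ℂ => ((‖z‖ ^ (-(1 / 2) : ℝ) * Real.exp (-ℓ ‖z‖) : ℝ) : ℂ) * z := by
    refine .of_punctured ((Complex.continuous_ofReal.comp_continuousOn
      ((hr _).mul hl.neg.rexp)).mul continuousOn_id) fun R => ?_
    obtain ⟨C, hC⟩ := isFiducialProfile_one_bdd hℓ R
    refine ⟨C, fun z hz hzR => ?_⟩
    have hz0 := norm_pos_iff.2 hz
    have h3 : ‖z‖ ^ (-(1 / 2) : ℝ) * ‖z‖ = ‖z‖ ^ (1 / 2 : ℝ) := by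
      rw [← Real.rpow_add_one hz0.ne']; norm_num
    rw [norm_mul, Complex.norm_real, Real.norm_eq_abs, abs_of_nonneg (by positivity), mul_right_comm,
      h3]
    exact (hC _ hz0 hzR).2.2
  intro i j
  fin_cases i <;> fin_cases j
  exacts [hz, h1, h2, hz]

/-! ### From smooth to `C¹` test functions -/

theorem norm_normed_convolution_le (φ : ContDiffBump (0 : ℂ)) (hφ : φ.rOut ≤ 1) {g : ℂ → ℝ}
    (hg : Continuous g) {R C : ℝ} (hR : ∀ z, R < ‖z‖ → g z = 0) (hC : ∀ z, |g z| ≤ C) (z : ℂ) :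
    |(φ.normed volume ⋆[ContinuousLinearMap.lsmul ℝ ℝ, volume] g) z| ≤
      (Metric.closedBall 0 (R + 1)).indicator (fun _ => C) z := by
  have key : ∀ ε, (∀ x ∈ Metric.ball z φ.rOut, |g x| ≤ ε) →
      |(φ.normed volume ⋆[ContinuousLinearMap.lsmul ℝ ℝ, volume] g) z| ≤ ε := by
    intro ε hε
    have hε0 : 0 ≤ ε := (abs_nonneg _).trans (hε z (Metric.mem_ball_self φ.rOut_pos))
    simpa [Real.dist_eq] using dist_convolution_le (z₀ := (0 : ℝ)) (x₀ := z) (g := g) hε0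
      φ.support_normed_eq.subset φ.nonneg_normed (φ.integral_normed (μ := volume))
      hg.aestronglyMeasurable (by simpa [Real.dist_eq] using hε)
  by_cases hz : z ∈ Metric.closedBall (0 : ℂ) (R + 1)
  · rw [indicator_of_mem hz]
    exact key C fun x _ => hC x
  · rw [indicator_of_notMem hz]
    refine key 0 fun x hx => ?_
    rw [hR x, abs_zero]
    simp only [mem_closedBall_zero_iff, not_le] at hz
    rw [Metric.mem_ball, dist_eq_norm] at hx
    have : ‖z‖ - ‖x‖ ≤ ‖x - z‖ := by rw [norm_sub_rev]; exact norm_sub_norm_le z x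
    linarith

/-- A first order linear identity with locally bounded coefficients that holds for all smooth
compactly supported functions holds for `C¹` compactly supported functions, by mollification. -/
theorem integral_eq_zero_of_contDiff_one {g₁ g₂ g₃ : ℂ → ℝ} (h₁ : LocBdd g₁) (h₂ : LocBdd g₂)
    (h₃ : LocBdd g₃)
    (h : ∀ f : ℂ → ℝ, ContDiff ℝ ∞ f → HasCompactSupport f →
      ∫ z, (fderiv ℝ f z 1 * g₁ z + fderiv ℝ f z Complex.I * g₂ z + f z * g₃ z) = 0)
    {f : ℂ → ℝ} (hf : ContDiff ℝ 1 f) (hfc : HasCompactSupport f) :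
    ∫ z, (fderiv ℝ f z 1 * g₁ z + fderiv ℝ f z Complex.I * g₂ z + f z * g₃ z) = 0 := by
  let φ : ℕ → ContDiffBump (0 : ℂ) := fun n =>
    ⟨1 / (2 * ((n : ℝ) + 1)), 1 / ((n : ℝ) + 1), by positivity, by
      rw [one_div_lt_one_div (by positivity) (by positivity)]
      have : (0 : ℝ) ≤ n := n.cast_nonneg
      linarith⟩
  have hφ1 : ∀ n, (φ n).rOut ≤ 1 := fun n => by
    change 1 / ((n : ℝ) + 1) ≤ 1
    rw [div_le_one (by positivity)]
    simp
  have hφ0 : Tendsto (fun n => (φ n).rOut) atTop (𝓝 0) := tendsto_one_div_add_atTop_nhds_zero_nat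
  let F : ℕ → ℂ → ℝ := fun n =>
    (φ n).normed volume ⋆[ContinuousLinearMap.lsmul ℝ ℝ, volume] f
  have hloc (n : ℕ) : LocallyIntegrable ((φ n).normed volume) (volume : Measure ℂ) :=
    (φ n).continuous_normed.locallyIntegrable
  have hdcont : ∀ w, Continuous fun z => fderiv ℝ f z w := fun w =>
    (hf.continuous_fderiv one_ne_zero).clm_apply continuous_const
  have hdc : ∀ w, HasCompactSupport fun z => fderiv ℝ f z w := fun w => hfc.fderiv_apply ℝ w
  have hFd (n : ℕ) (z w : ℂ) : fderiv ℝ (F n) z w =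
      ((φ n).normed volume ⋆[ContinuousLinearMap.lsmul ℝ ℝ, volume]
        fun x => fderiv ℝ f x w) z := by
    rw [(hfc.hasFDerivAt_convolution_right (ContinuousLinearMap.lsmul ℝ ℝ) (hloc n) hf z).fderiv,
      convolution_precompR_apply _ (hloc n) (hfc.fderiv ℝ)
        (hf.continuous_fderiv one_ne_zero)]
  have hFs : ∀ n, ContDiff ℝ ∞ (F n) := fun n =>
    (φ n).hasCompactSupport_normed.contDiff_convolution_left _ (φ n).contDiff_normed
      (hf.continuous.locallyIntegrable)
  have hFc : ∀ n, HasCompactSupport (F n) := fun n =>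
    HasCompactSupport.convolution _ (φ n).hasCompactSupport_normed hfc
  -- common bound and support radius for `f` and its two partial derivatives
  have hbd : ∀ g : ℂ → ℝ, Continuous g → HasCompactSupport g →
      ∃ C, ∀ R, (∀ z, R < ‖z‖ → g z = 0) → ∀ n z,
        |((φ n).normed volume ⋆[ContinuousLinearMap.lsmul ℝ ℝ, volume] g) z| ≤
          (Metric.closedBall 0 (R + 1)).indicator (fun _ => C) z := by
    intro g hg hgc
    obtain ⟨C, hC⟩ := hgc.exists_bound_of_continuous hg
    exact ⟨C, fun R hR n z => norm_normed_convolution_le _ (hφ1 n) hg hR hC z⟩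
  obtain ⟨R, hR⟩ := hfc.isCompact.isBounded.subset_closedBall (0 : ℂ)
  have hR0 : ∀ z, R < ‖z‖ → z ∉ tsupport f := fun z hz hm =>
    absurd (by simpa using hR hm) (not_le.2 hz)
  have hRf : ∀ z, R < ‖z‖ → f z = 0 := fun z hz => image_eq_zero_of_notMem_tsupport (hR0 z hz)
  have hRd : ∀ w z, R < ‖z‖ → fderiv ℝ f z w = 0 := fun w z hz => by
    rw [fderiv_of_notMem_tsupport (𝕜 := ℝ) (hR0 z hz)]; rfl
  obtain ⟨C₁, hC₁⟩ := hbd _ (hdcont 1) (hdc 1)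
  obtain ⟨C₂, hC₂⟩ := hbd _ (hdcont Complex.I) (hdc Complex.I)
  obtain ⟨C₃, hC₃⟩ := hbd _ hf.continuous hfc
  obtain ⟨M₁, hM₁⟩ := h₁.2 (R + 1)
  obtain ⟨M₂, hM₂⟩ := h₂.2 (R + 1)
  obtain ⟨M₃, hM₃⟩ := h₃.2 (R + 1)
  have hlim := tendsto_integral_of_dominated_convergence
    (F := fun n z => fderiv ℝ (F n) z 1 * g₁ z + fderiv ℝ (F n) z Complex.I * g₂ z + F n z * g₃ z)
    (f := fun z => fderiv ℝ f z 1 * g₁ z + fderiv ℝ f z Complex.I * g₂ z + f z * g₃ z)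
    (μ := volume)
    ((Metric.closedBall (0 : ℂ) (R + 1)).indicator fun _ => C₁ * M₁ + C₂ * M₂ + C₃ * M₃)
    (fun n => by
      have hc : ∀ w, AEStronglyMeasurable (fun z => fderiv ℝ (F n) z w) volume := fun w =>
        (((hFs n).continuous_fderiv (by simp)).clm_apply continuous_const).aestronglyMeasurable
      exact (((hc 1).mul h₁.1).add ((hc Complex.I).mul h₂.1)).add
        ((hFs n).continuous.aestronglyMeasurable.mul h₃.1))
    ((integrable_indicator_iff measurableSet_closedBall).2
      (integrableOn_const measure_closedBall_lt_top.ne))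
    (fun n => .of_forall fun z => by
      have e1 := hC₁ R (hRd 1) n z
      have e2 := hC₂ R (hRd Complex.I) n z
      have e3 := hC₃ R hRf n z
      rw [← hFd] at e1 e2
      by_cases hz : z ∈ Metric.closedBall (0 : ℂ) (R + 1)
      · rw [indicator_of_mem hz] at e1 e2 e3 ⊢
        have hz' : ‖z‖ ≤ R + 1 := by simpa using hz
        have mm : ∀ {a b C M : ℝ}, |a| ≤ C → ‖b‖ ≤ M → ‖a * b‖ ≤ C * M := fun ha hb => by
          rw [norm_mul]
          exact mul_le_mul ha hb (norm_nonneg _) ((abs_nonneg _).trans ha)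
        exact norm_add_le_of_le (norm_add_le_of_le (mm e1 (hM₁ z hz')) (mm e2 (hM₂ z hz')))
          (mm e3 (hM₃ z hz'))
      · rw [indicator_of_notMem hz] at e1 e2 e3 ⊢
        rw [abs_nonpos_iff] at e1 e2 e3
        simp only [F] at e1 e2 ⊢
        simp [e1, e2, e3])
    (.of_forall fun z => by
      have t : ∀ g : ℂ → ℝ, Continuous g → Tendsto (fun n =>
          ((φ n).normed volume ⋆[ContinuousLinearMap.lsmul ℝ ℝ, volume] g) z) atTop (𝓝 (g z)) :=
        fun g hg => ContDiffBump.convolution_tendsto_right_of_continuous hφ0 hg z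
      simp only [hFd]
      exact (((t _ (hdcont 1)).mul_const _).add ((t _ (hdcont Complex.I)).mul_const _)).add
        ((t _ hf.continuous).mul_const _))
  simp only [h _ (hFs _) (hFc _)] at hlim
  exact tendsto_nhds_unique hlim tendsto_const_nhds

/-! ### A Liouville theorem on the plane -/

/-- Standard cutoffs on dyadic discs: the Dirichlet energy of `χ n` is bounded, because in
dimension two `|dχ|² ≤ C 4⁻ⁿ` is integrated over an area `O(4ⁿ)`. -/
theorem exists_dyadic_cutoffs : ∃ (χ : ℕ → ℂ → ℝ) (K : ℝ), ∀ n, ContDiff ℝ ∞ (χ n) ∧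
    (∀ z, 0 ≤ χ n z ∧ χ n z ≤ 1) ∧ (∀ z, 2 ^ (n + 1) ≤ ‖z‖ → χ n z = 0) ∧
    (∀ z, ‖z‖ < 2 ^ n → χ n z = 1 ∧ fderiv ℝ (χ n) z = 0) ∧
    ∀ z, ‖fderiv ℝ (χ n) z‖ ≤
      (Metric.closedBall 0 (2 ^ (n + 1))).indicator (fun _ => K / 2 ^ n) z := by
  let b : ContDiffBump (0 : ℂ) := ⟨1, 2, one_pos, by norm_num⟩
  obtain ⟨K, hK⟩ := (b.hasCompactSupport.fderiv ℝ).exists_bound_of_continuous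
    ((b.contDiff (n := 1)).continuous_fderiv one_ne_zero)
  have hp (n : ℕ) : (0 : ℝ) < 2 ^ n := by positivity
  have hnorm (n : ℕ) (z : ℂ) : ‖((2 : ℝ) ^ n)⁻¹ • z‖ = ‖z‖ / 2 ^ n := by
    rw [norm_smul, norm_inv, Real.norm_eq_abs, abs_of_pos (hp n)]; ring
  have hzero : ∀ n z, 2 ^ (n + 1) ≤ ‖z‖ → b (((2 : ℝ) ^ n)⁻¹ • z) = 0 := fun n z hz => by
    refine b.zero_of_le_dist ?_
    rw [dist_zero_right, hnorm, le_div_iff₀ (hp n)]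
    change (2 : ℝ) * 2 ^ n ≤ ‖z‖
    rwa [← pow_succ']
  have hone : ∀ n z, ‖z‖ < 2 ^ n → b (((2 : ℝ) ^ n)⁻¹ • z) = 1 := fun n z hz => by
    refine b.one_of_mem_closedBall ?_
    rw [mem_closedBall_zero_iff, hnorm, div_le_iff₀ (hp n)]
    change ‖z‖ ≤ 1 * 2 ^ n
    linarith
  refine ⟨fun n z => b (((2 : ℝ) ^ n)⁻¹ • z), K, fun n => ⟨b.contDiff.comp (contDiff_const_smul _),
    fun z => ⟨b.nonneg, b.le_one⟩, hzero n, fun z hz => ⟨hone n z hz, ?_⟩, fun z => ?_⟩⟩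
  · have : (fun z => b (((2 : ℝ) ^ n)⁻¹ • z)) =ᶠ[𝓝 z] fun _ => 1 := by
      filter_upwards [(isOpen_lt continuous_norm continuous_const).mem_nhds hz] with x hx
      exact hone n x hx
    rw [this.fderiv_eq]; simp
  · by_cases hz : z ∈ Metric.closedBall (0 : ℂ) (2 ^ (n + 1))
    · rw [indicator_of_mem hz, fderiv_comp_smul, norm_smul, norm_inv, Real.norm_eq_abs,
        abs_of_pos (hp n), inv_mul_eq_div]
      gcongr
      exact hK _
    · rw [indicator_of_notMem hz]
      have : (fun z => b (((2 : ℝ) ^ n)⁻¹ • z)) =ᶠ[𝓝 z] fun _ => 0 := by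
        simp only [mem_closedBall_zero_iff, not_le] at hz
        filter_upwards [(isOpen_lt continuous_const continuous_norm).mem_nhds hz] with x hx
        exact hzero n x (le_of_lt hx)
      rw [this.fderiv_eq]; simp

theorem le_zero_of_caccioppoli {a b : ℕ → ℝ} {C : ℝ} (ha : ∀ n, 0 ≤ a n) (hab : ∀ n, a n ≤ b n)
    (hba : ∀ n, b n ≤ a (n + 1))
    (h : ∀ δ : ℝ, 0 < δ → ∀ n, b n ≤ δ⁻¹ * (b n - a n) + δ * C) (n : ℕ) : a n = 0 := by
  have hmono : Monotone a := monotone_nat_of_le_succ fun n => (hab n).trans (hba n)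
  have hbdd : BddAbove (range a) := ⟨4 * C, by
    rintro _ ⟨n, rfl⟩
    have := h 2 two_pos n
    linarith [ha n, hab n]⟩
  have hA := tendsto_atTop_ciSup hmono hbdd
  set s := ⨆ i, a i
  have hB : Tendsto b atTop (𝓝 s) :=
    tendsto_of_tendsto_of_tendsto_of_le_of_le hA (hA.comp (tendsto_add_atTop_nat 1)) hab hba
  have hs : ∀ δ : ℝ, 0 < δ → s ≤ δ * C := fun δ hδ => by
    have := le_of_tendsto_of_tendsto' hB (((hB.sub hA).const_mul δ⁻¹).add_const (δ * C)) (h δ hδ)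
    simpa using this
  have hs0 : s ≤ 0 := by
    have ht : Tendsto (fun δ : ℝ => δ * C) (𝓝[>] 0) (𝓝 0) := by
      have : Tendsto (fun δ : ℝ => δ * C) (𝓝 0) (𝓝 (0 * C)) := tendsto_id.mul_const C
      rw [zero_mul] at this
      exact this.mono_left nhdsWithin_le_nhds
    exact ge_of_tendsto ht (eventually_mem_nhdsWithin.mono hs)
  exact le_antisymm ((le_ciSup hbdd n).trans hs0) (ha n)

/-- A Liouville theorem on the plane. If `e = div h` weakly, where `e ≥ 0` and `|h|² ≤ M e`, then
`e` vanishes. With `h = ∇u` and `e = Δu` this says that a function `u` with `|∇u|² ≤ M Δu` is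
harmonic; for `u = ½|γ|²` the hypothesis holds with `M` a bound for `|γ|²`.
Testing with squares of cutoffs gives the Caccioppoli inequality; since the Dirichlet energy of the
cutoffs is only bounded and does not tend to `0`, a first use of it shows that `e` is integrable and
a second one, on annuli, that its integral is `0`. -/
theorem ae_eq_zero_of_weak_divergence {e h₁ h₂ : ℂ → ℝ} {M : ℝ} (hM : 0 < M) (he : LocBdd e)
    (hh₁ : LocBdd h₁) (hh₂ : LocBdd h₂) (he0 : ∀ z, 0 ≤ e z)
    (hh : ∀ z, h₁ z ^ 2 + h₂ z ^ 2 ≤ M * e z)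
    (hw : ∀ ψ : ℂ → ℝ, ContDiff ℝ ∞ ψ → HasCompactSupport ψ →
      ∫ z, (ψ z * e z + (fderiv ℝ ψ z 1 * h₁ z + fderiv ℝ ψ z Complex.I * h₂ z)) = 0) :
    e =ᵐ[volume] 0 := by
  obtain ⟨χ, K, hχ⟩ := exists_dyadic_cutoffs
  have hint (n : ℕ) : IntegrableOn e (Metric.ball 0 (2 ^ n)) := he.integrableOn_ball _
  let a : ℕ → ℝ := fun n => ∫ z, (Metric.ball (0 : ℂ) (2 ^ n)).indicator e z
  let b : ℕ → ℝ := fun n => ∫ z, χ n z ^ 2 * e z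
  have hai (n : ℕ) : Integrable ((Metric.ball (0 : ℂ) (2 ^ n)).indicator e) :=
    (integrable_indicator_iff measurableSet_ball).2 (hint n)
  have hbi (n : ℕ) : Integrable fun z => χ n z ^ 2 * e z := by
    obtain ⟨hs, -, h0, -, -⟩ := hχ n
    refine ((LocBdd.of_continuous (hs.continuous.pow 2)).mul he).integrable_of_eq_zero
      (R := 2 ^ (n + 1)) fun z hz => ?_
    simp [h0 z hz.le]
  have ha0 (n : ℕ) : 0 ≤ a n := integral_nonneg fun z => indicator_nonneg (fun z _ => he0 z) z
  have hab (n : ℕ) : a n ≤ b n := by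
    refine integral_mono (hai n) (hbi n) fun z => ?_
    by_cases hz : z ∈ Metric.ball (0 : ℂ) (2 ^ n)
    · rw [indicator_of_mem hz]
      simp [((hχ n).2.2.2.1 z (by simpa using hz)).1]
    · rw [indicator_of_notMem hz]
      exact mul_nonneg (sq_nonneg _) (he0 z)
  have hba (n : ℕ) : b n ≤ a (n + 1) := by
    refine integral_mono (hbi n) (hai (n + 1)) fun z => ?_
    obtain ⟨-, h01, h0, -, -⟩ := hχ n
    by_cases hz : z ∈ Metric.ball (0 : ℂ) (2 ^ (n + 1))
    · rw [indicator_of_mem hz]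
      exact mul_le_of_le_one_left (he0 z) (pow_le_one₀ (h01 z).1 (h01 z).2)
    · rw [indicator_of_notMem hz]
      simp [h0 z (by simpa using hz)]
  have hcac : ∀ δ : ℝ, 0 < δ → ∀ n,
      b n ≤ δ⁻¹ * (b n - a n) + δ * (8 * M * K ^ 2 * Real.pi) := by
    intro δ hδ n
    obtain ⟨hs, h01, h0, h1, hd⟩ := hχ n
    let ψ : ℂ → ℝ := fun z => χ n z ^ 2
    have hψc : HasCompactSupport ψ := HasCompactSupport.intro
      (isCompact_closedBall (0 : ℂ) (2 ^ (n + 1))) fun z hz => by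
        simp only [mem_closedBall_zero_iff, not_le] at hz
        simp [ψ, h0 z hz.le]
    have hψd (z w : ℂ) : fderiv ℝ ψ z w = 2 * χ n z * fderiv ℝ (χ n) z w := by
      have := ((hs.differentiable (by simp)) z).hasFDerivAt.pow 2
      rw [this.fderiv]
      simp
    have hzero := hw ψ (hs.pow 2) hψc
    let G : ℂ → ℝ := (Metric.closedBall (0 : ℂ) (2 ^ (n + 1))).indicator
      fun _ => 2 * M * (K / 2 ^ n) ^ 2
    have hGi : Integrable G := (integrable_indicator_iff measurableSet_closedBall).2
      (integrableOn_const measure_closedBall_lt_top.ne)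
    have hG : ∫ z, G z = 8 * M * K ^ 2 * Real.pi := by
      rw [integral_indicator measurableSet_closedBall, setIntegral_const, Measure.real,
        Complex.volume_closedBall]
      simp only [ENNReal.toReal_mul, ENNReal.toReal_pow, smul_eq_mul, ENNReal.coe_toReal,
        NNReal.coe_real_pi]
      rw [ENNReal.toReal_ofReal (by positivity), pow_succ]
      field_simp
      ring
    have hcd (w : ℂ) : LocBdd fun z => fderiv ℝ ψ z w := .of_continuous
      (((hs.pow 2).continuous_fderiv (by simp)).clm_apply continuous_const)
    have hFi : Integrable fun z => ψ z * e z +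
        (fderiv ℝ ψ z 1 * h₁ z + fderiv ℝ ψ z Complex.I * h₂ z) := by
      refine (hbi n).add ((((hcd 1).mul hh₁).add
        ((hcd Complex.I).mul hh₂)).integrable_of_eq_zero (R := 2 ^ (n + 1)) fun z hz => ?_)
      simp [hψd, h0 z hz.le]
    have hpt (z : ℂ) : χ n z ^ 2 * e z - δ⁻¹ * (χ n z ^ 2 * e z -
        (Metric.ball (0 : ℂ) (2 ^ n)).indicator e z) - δ * G z ≤ ψ z * e z +
        (fderiv ℝ ψ z 1 * h₁ z + fderiv ℝ ψ z Complex.I * h₂ z) := by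
      have hG0 : 0 ≤ G z := indicator_nonneg (fun _ _ => by positivity) z
      by_cases hz : z ∈ Metric.ball (0 : ℂ) (2 ^ n)
      · obtain ⟨h2, h3⟩ := h1 z (by simpa using hz)
        rw [indicator_of_mem hz]
        simp only [hψd, ψ, h2, h3]
        have := mul_nonneg hδ.le hG0
        simp
        linarith
      · rw [indicator_of_notMem hz]
        simp only [hψd, ψ, sub_zero]
        set p := fderiv ℝ (χ n) z 1
        set q := fderiv ℝ (χ n) z Complex.I
        have hpq : M * (p ^ 2 + q ^ 2) ≤ G z := by
          have hp : ‖p‖ ≤ _ := (fderiv ℝ (χ n) z).le_of_opNorm_le (hd z) 1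
          have hq : ‖q‖ ≤ _ := (fderiv ℝ (χ n) z).le_of_opNorm_le (hd z) Complex.I
          simp only [norm_one, Complex.norm_I, mul_one, Real.norm_eq_abs] at hp hq
          by_cases hz' : z ∈ Metric.closedBall (0 : ℂ) (2 ^ (n + 1))
          · simp only [G]
            rw [indicator_of_mem hz'] at hp hq ⊢
            have hp2 := sq_le_sq' (abs_le.1 hp).1 (abs_le.1 hp).2
            have hq2 := sq_le_sq' (abs_le.1 hq).1 (abs_le.1 hq).2
            calc M * (p ^ 2 + q ^ 2) ≤ M * ((K / 2 ^ n) ^ 2 + (K / 2 ^ n) ^ 2) := by gcongr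
              _ = _ := by ring
          · simp only [G]
            rw [indicator_of_notMem hz'] at hp hq ⊢
            rw [abs_nonpos_iff] at hp hq
            simp [hp, hq]
        have hMd : 0 < M * δ := mul_pos hM hδ
        -- Young's inequality with weight `M δ`
        have hy : ∀ x y : ℝ, -(x ^ 2 / (M * δ) + M * δ * y ^ 2) ≤ 2 * x * y := fun x y => by
          have : 0 ≤ (x + M * δ * y) ^ 2 / (M * δ) := by positivity
          have e : (x + M * δ * y) ^ 2 / (M * δ) =
              x ^ 2 / (M * δ) + M * δ * y ^ 2 + 2 * x * y := by field_simp; ring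
          linarith
        have y1 := hy (χ n z * h₁ z) p
        have y2 := hy (χ n z * h₂ z) q
        have hsq : (χ n z * h₁ z) ^ 2 / (M * δ) + (χ n z * h₂ z) ^ 2 / (M * δ) ≤
            δ⁻¹ * (χ n z ^ 2 * e z) := by
          calc _ = χ n z ^ 2 * (h₁ z ^ 2 + h₂ z ^ 2) / (M * δ) := by ring
            _ ≤ χ n z ^ 2 * (M * e z) / (M * δ) := by gcongr; exact hh z
            _ = _ := by field_simp
        have hpq' := mul_le_mul_of_nonneg_left hpq hδ.le
        linarith
    have hfin := integral_mono (((hbi n).sub (((hbi n).sub (hai n)).const_mul δ⁻¹)).sub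
      (hGi.const_mul δ)) hFi hpt
    rw [hzero, integral_sub' ((hbi n).sub (((hbi n).sub (hai n)).const_mul δ⁻¹))
      (hGi.const_mul δ), integral_sub' (hbi n) (((hbi n).sub (hai n)).const_mul δ⁻¹),
      integral_const_mul, integral_const_mul, hG, integral_sub' (hbi n) (hai n)] at hfin
    change b n - δ⁻¹ * (b n - a n) - _ ≤ 0 at hfin
    linarith
  have hz := le_zero_of_caccioppoli ha0 hab hba hcac
  have hzn : ∀ᵐ z : ℂ, ∀ n : ℕ, (Metric.ball (0 : ℂ) (2 ^ n)).indicator e z = 0 :=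
    ae_all_iff.2 fun n => (integral_eq_zero_iff_of_nonneg
      (fun z => indicator_nonneg (fun z _ => he0 z) z) (hai n)).1 (hz n)
  filter_upwards [hzn] with z hz
  obtain ⟨n, hn⟩ := pow_unbounded_of_one_lt ‖z‖ one_lt_two
  have := hz n
  rwa [indicator_of_mem (by simpa using hn)] at this

/-! ### The inner product on matrices -/

theorem inn_add_right (a b c : Mat) : inn a (b + c) = inn a b + inn a c := by
  simp [inn, Matrix.mul_add]

theorem inn_smul_right (a b : Mat) (t : ℝ) : inn a (t • b) = t * inn a b := by
  simp [inn]

theorem inn_sum_right {ι : Type*} (s : Finset ι) (a : Mat) (b : ι → Mat) :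
    inn a (∑ k ∈ s, b k) = ∑ k ∈ s, inn a (b k) := by
  simp [inn, Matrix.conjTranspose_sum, Matrix.mul_sum, Matrix.trace_sum]

theorem inn_comm (a b : Mat) : inn a b = inn b a := by
  simp only [inn, Matrix.trace_fin_two, Matrix.mul_apply, Fin.sum_univ_two,
    Matrix.conjTranspose_apply, RCLike.star_def, Complex.add_re, Complex.mul_re, Complex.conj_re,
    Complex.conj_im]
  ring

theorem inn_self (a : Mat) : inn a a = ∑ i, ∑ j, ‖a i j‖ ^ 2 := by
  simp only [inn, Matrix.trace_fin_two, Matrix.mul_apply, Fin.sum_univ_two,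
    Matrix.conjTranspose_apply, RCLike.star_def, Complex.mul_conj, ← Complex.normSq_eq_norm_sq]
  norm_cast

theorem inn_self_nonneg (a : Mat) : 0 ≤ inn a a := by
  rw [inn_self]; positivity

theorem inn_self_eq_zero {a : Mat} : inn a a = 0 ↔ a = 0 := by
  refine ⟨fun h => ?_, fun h => by simp [h, inn]⟩
  rw [inn_self] at h
  ext i j
  have h1 := (Finset.sum_eq_zero_iff_of_nonneg fun i _ => by positivity).1 h i (Finset.mem_univ i)
  have h2 := (Finset.sum_eq_zero_iff_of_nonneg fun j _ => by positivity).1 h1 j (Finset.mem_univ j)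
  simpa using h2

theorem inn_sq_le (a b : Mat) : inn a b ^ 2 ≤ inn a a * inn b b := by
  have h : ∀ t : ℝ, 0 ≤ inn b b * (t * t) + 2 * inn a b * t + inn a a := fun t => by
    have e : inn (a + t • b) (a + t • b) =
        inn b b * (t * t) + 2 * inn a b * t + inn a a := by
      rw [inn_add_right, inn_smul_right, inn_comm _ a, inn_comm _ b, inn_add_right, inn_add_right,
        inn_smul_right, inn_smul_right, inn_comm b a]
      ring
    exact e ▸ inn_self_nonneg _
  have := discrim_le_zero h
  rw [discrim] at this
  linarith

/-! ### Pauli coordinates -/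

/-- The Pauli matrices (the last one up to sign), a basis of `i 𝔰𝔲(2)` over `ℝ`. -/
def pauli : Fin 3 → Mat :=
  ![!![1, 0; 0, -1], !![0, 1; 1, 0], !![0, Complex.I; -Complex.I, 0]]

/-- The coordinates of a trace-free Hermitian matrix in the basis `pauli`. -/
def pauliCoord (m : Mat) : Fin 3 → ℝ := ![(m 0 0).re, (m 0 1).re, (m 0 1).im]

theorem pauli_mem (k : Fin 3) : pauli k ∈ isu2 := by
  fin_cases k <;> refine ⟨?_, ?_⟩ <;>
    first
    | (ext i j; fin_cases i <;> fin_cases j <;> simp [pauli])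
    | simp [pauli, Matrix.trace_fin_two]

theorem apply_of_mem_isu2 {m : Mat} (hm : m ∈ isu2) :
    m 1 1 = -m 0 0 ∧ m 1 0 = star (m 0 1) ∧ (m 0 0).im = 0 := by
  obtain ⟨h, ht⟩ := hm
  rw [Matrix.trace_fin_two] at ht
  exact ⟨(neg_eq_of_add_eq_zero_right ht).symm, (h.apply 1 0).symm,
    Complex.conj_eq_iff_im.1 (h.apply 0 0)⟩

theorem sum_pauliCoord {m : Mat} (hm : m ∈ isu2) : ∑ k, pauliCoord m k • pauli k = m := by
  obtain ⟨h11, h10, h00⟩ := apply_of_mem_isu2 hm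
  ext i j
  fin_cases i <;> fin_cases j <;>
    apply Complex.ext <;> simp [Fin.sum_univ_three, pauli, pauliCoord, h11, h10, h00]

theorem smul_mem_isu2 {m : Mat} (hm : m ∈ isu2) (t : ℝ) : t • m ∈ isu2 := by
  refine ⟨?_, by rw [Matrix.trace_smul, hm.2, smul_zero]⟩
  rw [Matrix.IsHermitian, Matrix.conjTranspose_smul, hm.1.eq, star_trivial]

theorem contDiff_pauliCoord {γ : ℂ → Mat} (hγ : ∀ i j, ContDiff ℝ 1 fun z => γ z i j)
    (k : Fin 3) : ContDiff ℝ 1 fun z => pauliCoord (γ z) k := by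
  fin_cases k
  exacts [Complex.reCLM.contDiff.comp (hγ 0 0), Complex.reCLM.contDiff.comp (hγ 0 1),
    Complex.imCLM.contDiff.comp (hγ 0 1)]

theorem covDeriv_smul_const (A : OneForm) {f : ℂ → ℝ} {z : ℂ} (hf : DifferentiableAt ℝ f z)
    (m : Mat) (w : ℂ) :
    covDeriv A (fun x => f x • m) z w = fderiv ℝ f z w • m + f z • ⁅A z w, m⁆ := by
  have h : matDeriv (fun x => f x • m) z w = fderiv ℝ f z w • m := by
    ext i j
    simp only [matDeriv, Matrix.of_apply, Matrix.smul_apply]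
    rw [(hf.hasFDerivAt.smul_const (m i j)).fderiv]
    rfl
  simp only [covDeriv, h, Ring.lie_def, mul_smul_comm, smul_mul_assoc, smul_sub]

theorem covDeriv_eq_sum (A : OneForm) {γ : ℂ → Mat} (hmem : ∀ z, γ z ∈ isu2)
    (hγ : ∀ i j, ContDiff ℝ 1 fun z => γ z i j) (z w : ℂ) :
    covDeriv A γ z w = ∑ k, (fderiv ℝ (fun x => pauliCoord (γ x) k) z w • pauli k +
      pauliCoord (γ z) k • ⁅A z w, pauli k⁆) := by
  have h : matDeriv γ z w = ∑ k, fderiv ℝ (fun x => pauliCoord (γ x) k) z w • pauli k := by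
    ext i j
    have e : (fun x => γ x i j) = fun x => ∑ k, pauliCoord (γ x) k • pauli k i j := by
      funext x
      conv_lhs => rw [← sum_pauliCoord (hmem x)]
      simp [Matrix.sum_apply]
    have hd := HasFDerivAt.fun_sum (u := Finset.univ) fun k _ =>
      ((contDiff_pauliCoord hγ k).differentiable one_ne_zero z).hasFDerivAt.smul_const
        (pauli k i j)
    rw [← e] at hd
    simp only [matDeriv, Matrix.of_apply]
    rw [hd.fderiv]
    simp [Matrix.sum_apply]
  rw [covDeriv, h, Finset.sum_add_distrib]
  congr 1
  conv_lhs => rw [← sum_pauliCoord (hmem z)]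
  simp only [Ring.lie_def, Finset.mul_sum, Finset.sum_mul, mul_smul_comm, smul_mul_assoc, smul_sub,
    Finset.sum_sub_distrib]

/-! ### The energy identity -/

/-- The energy density `|d_A γ|² + ⟨-i ∗ M_Φ γ, γ⟩`. -/
noncomputable def energyDensity (A Φ : OneForm) (γ : ℂ → Mat) (z : ℂ) : ℝ :=
  (covDeriv A γ).inn (covDeriv A γ) z + inn (higgsPotential Φ γ z) (γ z)

/-- The energy identity: testing the equation with `ψ γ` shows that the energy density is the weak
divergence of `w ↦ ⟨d_A γ(w), γ⟩`. Since `ψ γ` is only `C¹`, it is split into its Pauli components,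
to which mollification applies. -/
theorem IsWeakSolution.integral_energyDensity {A Φ : OneForm} {γ : ℂ → Mat}
    (hA : ∀ w, MatLocBdd fun z => A z w) (hΦ : ∀ w, MatLocBdd fun z => Φ z w)
    (hmem : ∀ z, γ z ∈ isu2) (hγ : ∀ i j, ContDiff ℝ 1 fun z => γ z i j)
    (hsol : IsWeakSolution A Φ γ) {ψ : ℂ → ℝ} (hψ : ContDiff ℝ ∞ ψ) (hψc : HasCompactSupport ψ) :
    ∫ z, (ψ z * energyDensity A Φ γ z + (fderiv ℝ ψ z 1 * inn (covDeriv A γ z 1) (γ z) +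
      fderiv ℝ ψ z Complex.I * inn (covDeriv A γ z Complex.I) (γ z))) = 0 := by
  have hγb : MatLocBdd γ := fun i j => .of_continuous (hγ i j).continuous
  have hD := MatLocBdd.covDeriv hA hγ
  have hV := MatLocBdd.higgsPotential hΦ hγb
  let c : Fin 3 → ℂ → ℝ := fun k z => pauliCoord (γ z) k
  have hc : ∀ k, ContDiff ℝ 1 (c k) := contDiff_pauliCoord hγ
  let g : ℂ → Fin 3 → ℂ → ℝ := fun w k z => inn (covDeriv A γ z w) (pauli k)
  let g₃ : Fin 3 → ℂ → ℝ := fun k z => inn (covDeriv A γ z 1) ⁅A z 1, pauli k⁆ +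
    inn (covDeriv A γ z Complex.I) ⁅A z Complex.I, pauli k⁆ +
    inn (higgsPotential Φ γ z) (pauli k)
  have hg : ∀ w k, LocBdd (g w k) := fun w k => (hD w).inn (.const _)
  have hg₃ : ∀ k, LocBdd (g₃ k) := fun k =>
    (((hD 1).inn ((hA 1).lie (.const _))).add
      ((hD Complex.I).inn ((hA Complex.I).lie (.const _)))).add (hV.inn (.const _))
  let f : Fin 3 → ℂ → ℝ := fun k z => ψ z * c k z
  have hf : ∀ k, ContDiff ℝ 1 (f k) := fun k => (hψ.of_le (by simp)).mul (hc k)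
  have hfc : ∀ k, HasCompactSupport (f k) := fun k => hψc.mul_right
  let J : Fin 3 → ℂ → ℝ := fun k z =>
    fderiv ℝ (f k) z 1 * g 1 k z + fderiv ℝ (f k) z Complex.I * g Complex.I k z + f k z * g₃ k z
  have hzero : ∀ k, ∫ z, J k z = 0 := fun k => by
    refine integral_eq_zero_of_contDiff_one (hg 1 k) (hg _ k) (hg₃ k) (fun u hu huc => ?_)
      (hf k) (hfc k)
    have := hsol (fun z => u z • pauli k) (fun i j => hu.smul contDiff_const) huc.smul_right
      fun z => smul_mem_isu2 (pauli_mem k) _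
    rw [← this]
    congr 1
    funext z
    simp only [OneForm.inn, covDeriv_smul_const A ((hu.differentiable (by simp)) z),
      inn_add_right, inn_smul_right, g, g₃]
    ring
  have hint : ∀ k, Integrable (J k) := fun k => by
    obtain ⟨R, hR⟩ := (hfc k).isCompact.isBounded.subset_closedBall (0 : ℂ)
    have hd : ∀ w, LocBdd fun z => fderiv ℝ (f k) z w := fun w => .of_continuous
      (((hf k).continuous_fderiv one_ne_zero).clm_apply continuous_const)
    refine ((((hd 1).mul (hg 1 k)).add ((hd Complex.I).mul (hg Complex.I k))).add
      ((LocBdd.of_continuous (hf k).continuous).mul (hg₃ k))).integrable_of_eq_zero (R := R)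
      fun z hz => ?_
    have hz' : z ∉ tsupport (f k) := fun hm => absurd (by simpa using hR hm) (not_le.2 hz)
    simp [fderiv_of_notMem_tsupport (𝕜 := ℝ) hz', image_eq_zero_of_notMem_tsupport hz']
  have hsum : ∫ z, ∑ k, J k z = 0 := by
    rw [integral_finsetSum _ fun k _ => hint k]
    exact Finset.sum_eq_zero fun k _ => hzero k
  rw [← hsum]
  congr 1
  funext z
  have hfd (k : Fin 3) (w : ℂ) :
      fderiv ℝ (f k) z w = ψ z * fderiv ℝ (c k) z w + c k z * fderiv ℝ ψ z w := by
    have := ((hψ.differentiable (by simp)) z).hasFDerivAt.mul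
      ((hc k).differentiable one_ne_zero z).hasFDerivAt
    change fderiv ℝ (ψ * c k) z w = _
    rw [this.fderiv]
    simp
  have hγs (a : Mat) : inn a (γ z) = ∑ k, c k z * inn a (pauli k) := by
    conv_lhs => rw [← sum_pauliCoord (hmem z)]
    simp only [inn_sum_right, inn_smul_right, c]
  have hDs (a : Mat) (w : ℂ) : inn a (covDeriv A γ z w) =
      ∑ k, (fderiv ℝ (c k) z w * inn a (pauli k) + c k z * inn a ⁅A z w, pauli k⁆) := by
    rw [covDeriv_eq_sum A hmem hγ]
    simp only [inn_sum_right, inn_add_right, inn_smul_right, c]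
  simp only [energyDensity, OneForm.inn]
  rw [hγs, hγs, hγs, hDs, hDs]
  simp only [J, hfd, g, g₃, f, Fin.sum_univ_three]
  ring

/-- For a Higgs field `φ dz` and Hermitian `γ`, the zeroth order term is non-negative. -/
theorem inn_higgsPotential {Φ : OneForm} {γ : ℂ → Mat} {z : ℂ} {φ : Mat}
    (hΦ : ∀ w, Φ z w = w • φ) (hγ : γ z ∈ isu2) :
    inn (higgsPotential Φ γ z) (γ z) = 4 * inn ⁅φ, γ z⁆ ⁅φ, γ z⁆ := by
  have hV : higgsPotential Φ γ z =
      (2 : ℂ) • (⁅φ.conjTranspose, ⁅φ, γ z⁆⁆ + ⁅φ, ⁅φ.conjTranspose, γ z⁆⁆) := by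
    simp only [higgsPotential, TwoForm.star, higgsM, OneForm.wedge, OneForm.bracket, OneForm.adj,
      hΦ, one_smul, Matrix.conjTranspose_smul, RCLike.star_def, Complex.conj_I, Ring.lie_def,
      smul_mul_assoc, mul_smul_comm, mul_sub, sub_mul]
    match_scalars <;> apply Complex.ext <;> simp <;> norm_num
  obtain ⟨h11, h10, h00⟩ := apply_of_mem_isu2 hγ
  rw [hV]
  simp only [inn, Ring.lie_def, Matrix.trace_fin_two, Matrix.mul_apply, Fin.sum_univ_two,
    Matrix.conjTranspose_apply, Matrix.sub_apply, Matrix.add_apply, Matrix.smul_apply, h11, h10,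
    RCLike.star_def, Complex.add_re, Complex.mul_re, Complex.mul_im, Complex.conj_re,
    Complex.conj_im, Complex.sub_re, Complex.sub_im, Complex.add_im, Complex.neg_re,
    Complex.neg_im, h00, smul_eq_mul, Complex.re_ofNat, Complex.im_ofNat]
  ring

/-! ### Rigidity of parallel sections -/

theorem inn_lie_eq_zero (a : Mat) {m : Mat} (hm : m ∈ isu2) : inn ⁅a, m⁆ m = 0 := by
  rw [inn, hm.1.eq, Ring.lie_def, sub_mul, Matrix.trace_sub, Matrix.mul_assoc m a m,
    Matrix.trace_mul_comm m (a * m), sub_self, Complex.zero_re]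

theorem contDiff_inn_self {γ : ℂ → Mat} (hγ : ∀ i j, ContDiff ℝ 1 fun z => γ z i j) :
    ContDiff ℝ 1 fun z => inn (γ z) (γ z) := by
  simp only [inn_self]
  exact ContDiff.sum fun i _ => ContDiff.sum fun j _ => (hγ i j).norm_sq ℝ

/-- The connection is metric: `d |γ|² = 2 ⟨d_A γ, γ⟩`. For Hermitian `γ` this holds whatever
matrices `A` takes values in, since `tr ([A, γ] γ) = 0`. -/
theorem fderiv_inn_self (A : OneForm) {γ : ℂ → Mat} (hmem : ∀ z, γ z ∈ isu2)
    (hγ : ∀ i j, ContDiff ℝ 1 fun z => γ z i j) (z w : ℂ) :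
    fderiv ℝ (fun x => inn (γ x) (γ x)) z w = 2 * inn (covDeriv A γ z w) (γ z) := by
  have h : inn (covDeriv A γ z w) (γ z) = inn (matDeriv γ z w) (γ z) := by
    rw [covDeriv, inn_comm, inn_add_right, inn_comm _ ⁅_, _⁆, inn_lie_eq_zero _ (hmem z),
      add_zero, inn_comm]
  have hd := HasFDerivAt.fun_sum (u := Finset.univ) fun i _ =>
    HasFDerivAt.fun_sum (u := Finset.univ) fun j _ =>
      ((hγ i j).differentiable one_ne_zero z).hasFDerivAt.norm_sq
  simp only [inn_self]
  rw [h, hd.fderiv]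
  simp only [Fin.sum_univ_two, add_apply, smul_apply,
    ContinuousLinearMap.comp_apply, innerSL_apply_apply, Complex.inner, inn, matDeriv,
    Matrix.trace_fin_two, Matrix.mul_apply, Matrix.conjTranspose_apply, Matrix.of_apply,
    RCLike.star_def, Complex.add_re, nsmul_eq_mul]
  push_cast
  ring

/-- Where the profile is positive the two entries of the Higgs field have different moduli, so that
no non-zero trace-free Hermitian matrix commutes with it. -/
theorem eq_zero_of_lie_fidPhi_eq_zero {ℓ : ℝ → ℝ} {z : ℂ} (hz : z ≠ 0) (hl : 0 < ℓ ‖z‖) {m : Mat}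
    (hm : m ∈ isu2) (h : ⁅fidPhi ℓ z 1, m⁆ = 0) : m = 0 := by
  obtain ⟨h11, h10, -⟩ := apply_of_mem_isu2 hm
  have hr := norm_pos_iff.2 hz
  simp only [fidPhi, one_smul, Ring.lie_def] at h
  set p : ℝ := ‖z‖ ^ (1 / 2 : ℝ) * Real.exp (ℓ ‖z‖) with hp
  set q : ℂ := ((‖z‖ ^ (-(1 / 2) : ℝ) * Real.exp (-ℓ ‖z‖) : ℝ) : ℂ) * z with hq
  have hp0 : 0 < p := by positivity
  have hq' : ‖q‖ = ‖z‖ ^ (1 / 2 : ℝ) * Real.exp (-ℓ ‖z‖) := by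
    have h3 : ‖z‖ ^ (-(1 / 2) : ℝ) * ‖z‖ = ‖z‖ ^ (1 / 2 : ℝ) := by
      rw [← Real.rpow_add_one hr.ne']; norm_num
    rw [hq, norm_mul, Complex.norm_real, Real.norm_eq_abs, abs_of_nonneg (by positivity),
      mul_right_comm, h3]
  have hpq : ‖q‖ < p := by
    rw [hq', hp]
    have : Real.exp (-ℓ ‖z‖) < Real.exp (ℓ ‖z‖) := Real.exp_lt_exp.2 (by linarith)
    gcongr
  have e00 := congrFun₂ h 0 0
  have e01 := congrFun₂ h 0 1
  simp only [Matrix.sub_apply, Matrix.mul_apply, Fin.sum_univ_two, Matrix.of_apply,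
    Matrix.cons_val', Matrix.cons_val_zero, Matrix.cons_val_one, Matrix.cons_val_fin_one,
    Matrix.zero_apply, zero_mul, mul_zero, add_zero, zero_add, h11, h10] at e00 e01
  have hu : m 0 0 = 0 := by
    have : (-2 * (p : ℂ)) * m 0 0 = 0 := by linear_combination e01
    have hpc : (p : ℂ) ≠ 0 := by exact_mod_cast hp0.ne'
    simpa [hpc] using this
  have hv : m 0 1 = 0 := by
    have := congrArg norm (sub_eq_zero.1 e00)
    rw [norm_mul, norm_mul, norm_star, Complex.norm_real, Real.norm_eq_abs, abs_of_pos hp0] at this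
    by_contra hne
    have hn := norm_pos_iff.2 hne
    nlinarith
  ext i j
  fin_cases i <;> fin_cases j <;> simp [h11, h10, hu, hv]

end Fiducial

open Fiducial MeasureTheory in
theorem mainTheorem11 (ℓ : ℝ → ℝ) (hℓ : Fiducial.IsFiducialProfile 1 ℓ)
    (α : ℝ≥0) (hα₀ : 0 < α) (hα₁ : α < 1)
    (γ : ℂ → Fiducial.Mat) (hγ : ∀ z, γ z ∈ Fiducial.isu2)
    (hreg : Fiducial.IsC1HolderLoc α γ)
    (hsol : Fiducial.IsWeakSolution (Fiducial.fidA ℓ) (Fiducial.fidPhi ℓ) γ)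
    (hbdd : Fiducial.IsBdd γ) :
    ∀ z, γ z = 0 := by
  have hC1 : ∀ i j, ContDiff ℝ 1 fun z => γ z i j := fun i j => (hreg i j).1
  have hA := matLocBdd_fidA hℓ
  have hΦ := matLocBdd_fidPhi hℓ
  have hγb : MatLocBdd γ := fun i j => .of_continuous (hC1 i j).continuous
  have hD := MatLocBdd.covDeriv hA hC1
  have hV (z : ℂ) : inn (higgsPotential (fidPhi ℓ) γ z) (γ z) =
      4 * inn ⁅fidPhi ℓ z 1, γ z⁆ ⁅fidPhi ℓ z 1, γ z⁆ :=
    inn_higgsPotential (fun w => by simp only [fidPhi, one_smul]) (hγ z)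
  have hV0 (z : ℂ) : 0 ≤ inn (higgsPotential (fidPhi ℓ) γ z) (γ z) := by
    rw [hV]
    exact mul_nonneg (by norm_num) (inn_self_nonneg _)
  obtain ⟨C, hC⟩ := hbdd
  have hN (z : ℂ) : inn (γ z) (γ z) ≤ 4 * C ^ 2 + 1 := by
    have h (i j : Fin 2) : ‖γ z i j‖ ^ 2 ≤ C ^ 2 := by
      have := hC z i j
      gcongr
    rw [inn_self]
    simp only [Fin.sum_univ_two]
    linarith [h 0 0, h 0 1, h 1 0, h 1 1]
  have he0 (z : ℂ) : 0 ≤ energyDensity (fidA ℓ) (fidPhi ℓ) γ z :=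
    add_nonneg (add_nonneg (inn_self_nonneg _) (inn_self_nonneg _)) (hV0 z)
  have hae := ae_eq_zero_of_weak_divergence (M := 4 * C ^ 2 + 1) (by positivity)
    ((((hD 1).inn (hD 1)).add ((hD Complex.I).inn (hD Complex.I))).add
      ((MatLocBdd.higgsPotential hΦ hγb).inn hγb))
    ((hD 1).inn hγb) ((hD Complex.I).inn hγb) he0
    (fun z => by
      have hle (w : ℂ) : inn (covDeriv (fidA ℓ) γ z w) (γ z) ^ 2 ≤
          (4 * C ^ 2 + 1) * inn (covDeriv (fidA ℓ) γ z w) (covDeriv (fidA ℓ) γ z w) := by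
        rw [mul_comm]
        exact (inn_sq_le _ _).trans (mul_le_mul_of_nonneg_left (hN z) (inn_self_nonneg _))
      calc _ ≤ (4 * C ^ 2 + 1) * (covDeriv (fidA ℓ) γ).inn (covDeriv (fidA ℓ) γ) z :=
            (add_le_add (hle 1) (hle Complex.I)).trans_eq (mul_add _ _ _).symm
        _ ≤ _ := mul_le_mul_of_nonneg_left (le_add_of_nonneg_right (hV0 z)) (by positivity))
    (fun ψ hψ hψc => hsol.integral_energyDensity hA hΦ hγ hC1 hψ hψc)
  -- almost everywhere `γ` is parallel and commutes with the Higgs field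
  have hzero : ∀ᵐ z : ℂ, covDeriv (fidA ℓ) γ z 1 = 0 ∧ covDeriv (fidA ℓ) γ z Complex.I = 0 ∧
      ⁅fidPhi ℓ z 1, γ z⁆ = 0 := by
    filter_upwards [hae] with z hz
    have h1 := inn_self_nonneg (covDeriv (fidA ℓ) γ z 1)
    have h2 := inn_self_nonneg (covDeriv (fidA ℓ) γ z Complex.I)
    have h3 := inn_self_nonneg ⁅fidPhi ℓ z 1, γ z⁆
    simp only [Pi.zero_apply, hV] at hz
    exact ⟨inn_self_eq_zero.1 (by linarith), inn_self_eq_zero.1 (by linarith),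
      inn_self_eq_zero.1 (by linarith)⟩
  have hNc := contDiff_inn_self hC1
  have hdN (w : ℂ) (hw : ∀ᵐ z : ℂ, covDeriv (fidA ℓ) γ z w = 0) (z : ℂ) :
      fderiv ℝ (fun x => inn (γ x) (γ x)) z w = 0 := by
    have hcont : Continuous fun z => fderiv ℝ (fun x => inn (γ x) (γ x)) z w :=
      (hNc.continuous_fderiv one_ne_zero).clm_apply continuous_const
    refine congrFun ((hcont.ae_eq_iff_eq volume (continuous_const (y := (0 : ℝ)))).1 ?_) z
    filter_upwards [hw] with z hz
    rw [fderiv_inn_self (fidA ℓ) hγ hC1, hz]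
    simp [inn]
  have hconst : ∀ x y, inn (γ x) (γ x) = inn (γ y) (γ y) := by
    refine is_const_of_fderiv_eq_zero (𝕜 := ℝ) (hNc.differentiable one_ne_zero) fun z => ?_
    ext w
    have e : w = w.re • (1 : ℂ) + w.im • Complex.I := by simp
    rw [e, map_add, map_smul, map_smul, hdN 1 (hzero.mono fun z hz => hz.1),
      hdN Complex.I (hzero.mono fun z hz => hz.2.1)]
    simp
  obtain ⟨δ, _, hδ, hpos⟩ := isFiducialProfile_one_asymp hℓ
  -- a point of the punctured disc of radius `δ` where `γ` commutes with the Higgs field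
  obtain ⟨x, ⟨hx, hxδ⟩, hx0⟩ : ∃ x, (⁅fidPhi ℓ x 1, γ x⁆ = 0 ∧ x ∈ Metric.ball (0 : ℂ) δ) ∧
      x ≠ 0 := by
    have hfr : ∃ᶠ x in ae (volume : Measure ℂ), x ∈ Metric.ball (0 : ℂ) δ :=
      frequently_ae_mem_iff.2 (Metric.measure_ball_pos volume 0 hδ).ne'
    have hne : ∀ᵐ x : ℂ, x ≠ 0 := compl_mem_ae_iff.2 (measure_singleton 0)
    obtain ⟨x, hx, h1, h2⟩ := (hfr.and_eventually (hzero.and hne)).exists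
    exact ⟨x, ⟨h1.2.2, hx⟩, h2⟩
  have hγx : γ x = 0 := eq_zero_of_lie_fidPhi_eq_zero hx0
    (hpos _ ⟨norm_pos_iff.2 hx0, by simpa using hxδ⟩).1 (hγ x) hx
  intro z
  rw [← inn_self_eq_zero, hconst z x, hγx]
  simp [inn]
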